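/- Let $A$ be a finite totally ordered set and $A^*$ the free monoid on $A$. A column on $A$ is a strictly decreasing word on $A$, identified with the subset of $A$ consisting of its letters. For a letter $x\in A$ and a column $\gamma\subseteq A$, define $x\cdot\gamma$ (column insertion) by $x\cdot\gamma=\gamma\cup\{x\}$ if every element of $\gamma$ is $<x$, and otherwise $x\cdot\gamma=(\gamma\setminus\{y\})\cup\{x\}$, where $y$ is the smallest element of $\gamma$ with $y\ge x$. This extends to a left action of $A^*$ on the set $\mathcal C(A)$ of columns on $A$, i.e. to a monoid homomorphism $\mu$ from $A^*$ to the monoid of endofunctions of $\mathcal C(A)$ under composition. The stylic monoid is its image $\mathrm{Styl}(A)=\mu(A^*)$. Let $B_m$ denote the Bell number, the number of partitions of a set with $m$ elements. (i) If $|A|=n$, then $|\mathrm{Styl}(A)|=B_{n+1}$. (ii) $\mathrm{Styl}(A)$ is presented, on the generators $A$ (with $x\in A$ corresponding to $\mu(x)$), by the plactic (Knuth) relations $$bac=bca,\quad acb=cab\quad (a<b<c),\qquad baa=aba,\quad bba=bab\quad (a<b),$$ for $a,b,c\in A$, together with the idempotent relations $x^2=x$ for $x\in A$. That is, the quotient of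 $A^*$ by the congruence generated by these relations is isomorphic to $\mathrm{Styl}(A)$ by an isomorphism sending the class of each $x\in A$ to $\mu(x)$. -/

import Mathlib

namespace Stylic

/-- Column insertion of the letter `x` into the column `γ`, a column being identified with the
(finite) set of its letters. If some letter of `γ` is `≥ x`, the smallest such letter is bumped
(removed) and `x` is added; otherwise all letters of `γ` are `< x`, and `x` is just added. -/
def colInsert {A : Type*} [LinearOrder A] (x : A) (γ : Finset A) : Finset A :=
  if h : (γ.filter (fun y => x ≤ y)).Nonempty then
    insert x (γ.erase ((γ.filter (fun y => x ≤ y)).min' h))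
  else
    insert x γ

/-- Column insertion of the letter `x`, as an endofunction of the set of columns. -/
def letterAct {A : Type*} [LinearOrder A] (x : A) : Function.End (Finset A) :=
  colInsert x

/-- The left action of words on columns, as a homomorphism from the free monoid to the monoid of
endofunctions of the set of columns (the product being composition): the word `a₁ ⋯ aₖ` acts by
inserting first `aₖ`, then `aₖ₋₁`, and so on until `a₁`. -/
def wordAct (A : Type*) [LinearOrder A] : FreeMonoid A →* Function.End (Finset A) :=
  FreeMonoid.lift letterAct

/-- The stylic monoid: the monoid of all endofunctions of the set of columns that are given by the
action of some word. -/
abbrev Styl (A : Type*) [LinearOrder A] : Submonoid (Function.End (Finset A)) :=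
  MonoidHom.mrange (wordAct A)

/-- The canonical homomorphism from the free monoid onto the stylic monoid. -/
def toStyl (A : Type*) [LinearOrder A] : FreeMonoid A →* Styl A :=
  (wordAct A).mrangeRestrict

open FreeMonoid in
/-- The plactic (Knuth) relations. -/
inductive PlacticRel {A : Type*} [LinearOrder A] : FreeMonoid A → FreeMonoid A → Prop
  | bac_bca (a b c : A) : a < b → b < c →
      PlacticRel (of b * of a * of c) (of b * of c * of a)
  | acb_cab (a b c : A) : a < b → b < c →
      PlacticRel (of a * of c * of b) (of c * of a * of b)
  | baa_aba (a b : A) : a < b →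
      PlacticRel (of b * of a * of a) (of a * of b * of a)
  | bba_bab (a b : A) : a < b →
      PlacticRel (of b * of b * of a) (of b * of a * of b)

open FreeMonoid in
/-- The plactic relations together with the idempotent relations `x² = x` for each letter `x`. -/
inductive StylicRel {A : Type*} [LinearOrder A] : FreeMonoid A → FreeMonoid A → Prop
  | plactic (u v : FreeMonoid A) : PlacticRel u v → StylicRel u v
  | idem (x : A) : StylicRel (of x ^ 2) (of x)

/-- The Bell number `B_n`: the number of partitions of a set with `n` elements. -/
noncomputable def bellNumber (n : ℕ) : ℕ :=
  Nat.card (Finpartition (Finset.univ : Finset (Fin n)))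

end Stylic

namespace Stylic

variable {A : Type*} [LinearOrder A]

/-! Both claims rest on one set of normal forms, the stacks: lists of nonempty rows, each contained
in the row beneath it minus the least letter of that row.

Every word equals a stack word in the presented monoid: right multiplication by a letter is a row
insertion where, by idempotence, the bumped letter stays in its row while a copy of it moves up
(`row_mul_of`, `exists_stack_mul_of`). The relations hold in `Styl A` because a column is determined
by its ranks on lower sets, and insertion acts on these ranks by a max-plus formula
(`rank_colInsert`). Distinct stacks act differently, since their action on initial segments of `A`
reveals the bottom row, and then recursively the rows above it (`stack_eq_of_wordAct_eq`). Hence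
stacks, presented monoid and stylic monoid are in bijection.

Sorting stacks by whether the least letter `a` lies in the bottom row gives f(S ∪ {a}) = f(S) + ∑
f(T) over T ⊆ S, a recursion that the Bell numbers B_{|S|+1} also satisfy. -/

/-- The product of the generators along a list, in the monoid presented by the stylic relations. -/
def genProd (l : List A) : PresentedMonoid (StylicRel (A := A)) :=
  (l.map (PresentedMonoid.of StylicRel)).prod

@[simp] lemma genProd_nil : genProd ([] : List A) = 1 := rfl

@[simp] lemma genProd_cons (x : A) (l : List A) :
    genProd (x :: l) = PresentedMonoid.of StylicRel x * genProd l := by simp [genProd]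

@[simp] lemma genProd_append (l₁ l₂ : List A) :
    genProd (l₁ ++ l₂) = genProd l₁ * genProd l₂ := by simp [genProd]

/-! ### Consequences of the relations in the presented monoid -/

section Relations

local notation "g" => PresentedMonoid.of StylicRel

lemma of_idem (x : A) : g x * g x = g x := by
  have := PresentedMonoid.mk_eq_mk_of_rel (StylicRel.idem x)
  rwa [pow_two, map_mul] at this

lemma of_bac {a b c : A} (hab : a < b) (hbc : b < c) : g b * g a * g c = g b * g c * g a := by
  have := PresentedMonoid.mk_eq_mk_of_rel (StylicRel.plactic _ _ (PlacticRel.bac_bca a b c hab hbc))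
  simp only [map_mul] at this
  exact this

lemma of_acb {a b c : A} (hab : a < b) (hbc : b < c) : g a * g c * g b = g c * g a * g b := by
  have := PresentedMonoid.mk_eq_mk_of_rel (StylicRel.plactic _ _ (PlacticRel.acb_cab a b c hab hbc))
  simp only [map_mul] at this
  exact this

/-- Idempotence turns the two Knuth relations with a repeated letter into absorption: for a < b, the
product ba absorbs a on its left and b on its right. -/
lemma of_aba {a b : A} (hab : a < b) : g a * g b * g a = g b * g a := by
  have := PresentedMonoid.mk_eq_mk_of_rel (StylicRel.plactic _ _ (PlacticRel.baa_aba a b hab))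
  have h : g b * g a * g a = g a * g b * g a := by
    simp only [map_mul] at this
    exact this
  rw [← h, mul_assoc, of_idem]

lemma of_bab {a b : A} (hab : a < b) : g b * g a * g b = g b * g a := by
  have := PresentedMonoid.mk_eq_mk_of_rel (StylicRel.plactic _ _ (PlacticRel.bba_bab a b hab))
  have h : g b * g b * g a = g b * g a * g b := by
    simp only [map_mul] at this
    exact this
  rw [← h, of_idem]

/-- A letter commutes with an increasing word of smaller letters, up to the last letter. -/
lemma of_mul_genProd_mul_of {s l : A} (L : List A) (h : (L ++ [l]).Pairwise (· < ·)) (hs : l < s) :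
    g s * genProd L * g l = genProd L * g s * g l := by
  induction L using List.reverseRecOn generalizing l with
  | nil => simp
  | append_singleton L u ih =>
    have h' := List.pairwise_append.1 h
    have hul : u < l := h'.2.2 u (by simp) l (by simp)
    calc g s * genProd (L ++ [u]) * g l = g s * genProd L * g u * g l := by simp [mul_assoc]
      _ = genProd L * (g s * g u * g l) := by rw [ih h'.1 (hul.trans hs)]; simp [mul_assoc]
      _ = genProd (L ++ [u]) * g s * g l := by rw [← of_acb hul hs]; simp [mul_assoc]

/-- The first s moves right to just before the last letter l of `L`, where sls = sl, and then moves
back. Read backwards, this creates the copy of a bumped letter that stays in its row. -/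
lemma of_mul_genProd_mul_self {s : A} (L : List A) (h : (L ++ [s]).Pairwise (· < ·)) :
    g s * genProd L * g s = g s * genProd L := by
  induction L using List.reverseRecOn with
  | nil => simp [of_idem]
  | append_singleton L l ih =>
    have h' := List.pairwise_append.1 h
    have hl : l < s := h'.2.2 l (by simp) s (by simp)
    have e := of_mul_genProd_mul_of L h'.1 hl
    calc g s * genProd (L ++ [l]) * g s = g s * genProd L * g l * g s := by simp [mul_assoc]
      _ = genProd L * (g s * g l * g s) := by rw [e]; simp [mul_assoc]
      _ = g s * genProd L * g l := by rw [of_bab hl, e]; simp [mul_assoc]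
      _ = _ := by simp [mul_assoc]

/-- A letter smaller than all letters of an increasing word commutes with its tail. -/
lemma genProd_cons_mul_of {y s : A} (R : List A) (h : (s :: R).Pairwise (· < ·)) (hy : y < s) :
    genProd (s :: R) * g y = g s * g y * genProd R := by
  induction R generalizing s with
  | nil => simp
  | cons c R ih =>
    have h' := List.pairwise_cons.1 h
    have hc : s < c := h'.1 c (by simp)
    calc genProd (s :: c :: R) * g y = g s * (genProd (c :: R) * g y) := by
          rw [genProd_cons s, mul_assoc]
      _ = g s * g c * g y * genProd R := by rw [ih h'.2 (hy.trans hc)]; simp [mul_assoc]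
      _ = g s * g y * genProd (c :: R) := by rw [← of_bac hy hc]; simp [mul_assoc]

end Relations

/-! ### Row insertion and reduction to stacks -/

/-- The increasing word with a given set of letters. -/
def row (T : Finset A) : FreeMonoid A := FreeMonoid.ofList T.sort

lemma mk_ofList (l : List A) :
    PresentedMonoid.mk StylicRel (FreeMonoid.ofList l) = genProd l := by
  induction l with
  | nil => rfl
  | cons x l ih => rw [FreeMonoid.ofList_cons, map_mul, ih, genProd_cons]; rfl

lemma sort_union {S T : Finset A} (h : ∀ x ∈ S, ∀ y ∈ T, x < y) :
    (S ∪ T).sort = S.sort ++ T.sort := by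
  have hp : (S.sort ++ T.sort).Pairwise (· < ·) := by
    rw [List.pairwise_append]
    exact ⟨S.sortedLT_sort.pairwise, T.sortedLT_sort.pairwise, by simpa using h⟩
  have : (S.sort ++ T.sort).toFinset = S ∪ T := by simp
  rw [← this, List.toFinset_sort _ (hp.imp ne_of_lt)]
  exact hp.imp le_of_lt

lemma sort_eq_filter_append (y : A) (T : Finset A) :
    T.sort = (T.filter (· < y)).sort ++ (if y ∈ T then [y] else []) ++ (T.filter (y < ·)).sort := by
  have h₁ : ((if y ∈ T then {y} else ∅ : Finset A)).sort = if y ∈ T then [y] else [] := by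
    split_ifs <;> simp
  have h₂ : T = (T.filter (· < y) ∪ if y ∈ T then {y} else ∅) ∪ T.filter (y < ·) := by
    ext x
    rcases lt_trichotomy x y with h | rfl | h
    · split_ifs <;> simp [h, h.not_gt, h.ne]
    · split_ifs with hx <;> simp [hx]
    · split_ifs <;> simp [h, h.not_gt, h.ne']
  conv_lhs => rw [h₂]
  rw [sort_union, sort_union, h₁]
  · intro a ha b hb
    split_ifs at hb <;> grind
  · intro a ha b hb
    split_ifs at ha <;> grind

/-- Let s be the least letter of `T` above y, with `L` the letters below y and `R` those above s.
Then y moves left past `R`, s moves left past `L`, and s is duplicated: L s R y = L s y R = s L y R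
= s L y s R. If there is no s, then y is simply appended or absorbed. -/
lemma row_mul_of (T : Finset A) (y : A) :
    PresentedMonoid.mk StylicRel (row T * FreeMonoid.of y) =
        PresentedMonoid.mk StylicRel (row (insert y T)) ∨
      ∃ s ∈ T, y < s ∧ PresentedMonoid.mk StylicRel (row T * FreeMonoid.of y) =
        PresentedMonoid.mk StylicRel (FreeMonoid.of s * row (insert y T)) := by
  have e : ∀ s : A, PresentedMonoid.mk StylicRel (FreeMonoid.of s) =
    PresentedMonoid.of StylicRel s := fun _ => rfl
  have hlt : (insert y T).filter (· < y) = T.filter (· < y) := by grind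
  have hgt : (insert y T).filter (y < ·) = T.filter (y < ·) := by grind
  have hT := sort_eq_filter_append y T
  have hI := sort_eq_filter_append y (insert y T)
  rw [hlt, hgt, if_pos (Finset.mem_insert_self y T)] at hI
  have pL : ((T.filter (· < y)).sort ++ [y]).Pairwise (· < ·) := by
    rw [List.pairwise_append]
    exact ⟨(Finset.sortedLT_sort _).pairwise, by simp, by simp⟩
  have pR := (T.filter (y < ·)).sortedLT_sort.pairwise
  have mR : ∀ x ∈ (T.filter (y < ·)).sort, x ∈ T ∧ y < x := by simp
  simp only [map_mul, row, mk_ofList, e, hT, hI]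
  generalize (T.filter (· < y)).sort = L at *
  generalize (T.filter (y < ·)).sort = R at *
  cases R with
  | nil =>
    left
    split_ifs <;> simp [mul_assoc, of_idem]
  | cons s R =>
    obtain ⟨hs, hys⟩ := mR s (by simp)
    refine Or.inr ⟨s, hs, hys, ?_⟩
    have h₁ := genProd_cons_mul_of R pR hys
    have h₂ := of_mul_genProd_mul_of L pL hys
    have pLs : ((L ++ [y]) ++ [s]).Pairwise (· < ·) := by
      rw [List.pairwise_append] at pL ⊢
      refine ⟨List.pairwise_append.2 pL, by simp, fun a ha b hb => ?_⟩
      obtain rfl : b = s := by simpa using hb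
      rcases List.mem_append.1 ha with ha | ha
      · exact (pL.2.2 a ha y (by simp)).trans hys
      · obtain rfl : a = y := by simpa using ha
        exact hys
    have h₃ := of_mul_genProd_mul_self (L ++ [y]) pLs
    rw [genProd_append, genProd_cons y, genProd_nil, mul_one] at h₃
    -- If y is already in the row, the repeated y disappears by ysy = sy.
    have key : genProd (L ++ if y ∈ T then [y] else []) *
          (PresentedMonoid.of StylicRel s * PresentedMonoid.of StylicRel y) =
        genProd L * (PresentedMonoid.of StylicRel s * PresentedMonoid.of StylicRel y) := by
      split_ifs
      · simp only [genProd_append, genProd_cons, genProd_nil, mul_one]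
        rw [mul_assoc, ← mul_assoc (PresentedMonoid.of StylicRel y), of_aba hys]
      · simp
    calc _ = genProd (L ++ if y ∈ T then [y] else []) *
          (PresentedMonoid.of StylicRel s * PresentedMonoid.of StylicRel y) * genProd R := by
          rw [genProd_append _ (s :: R), mul_assoc, h₁]; simp only [mul_assoc]
      _ = PresentedMonoid.of StylicRel s * (genProd L * PresentedMonoid.of StylicRel y) *
          PresentedMonoid.of StylicRel s * genProd R := by
          rw [key, h₃, ← mul_assoc (genProd L), ← h₂, mul_assoc (PresentedMonoid.of StylicRel s)]
      _ = _ := by simp [mul_assoc]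

/-- A finset without its least element. -/
def eraseLeast (T : Finset A) : Finset A := T.filter fun x => ∃ y ∈ T, y < x

lemma mem_eraseLeast {T : Finset A} {x : A} : x ∈ eraseLeast T ↔ x ∈ T ∧ ∃ y ∈ T, y < x := by
  simp [eraseLeast]

lemma eraseLeast_subset (T : Finset A) : eraseLeast T ⊆ T := Finset.filter_subset _ _

lemma eraseLeast_mono {S T : Finset A} (h : S ⊆ T) : eraseLeast S ⊆ eraseLeast T := by
  intro x
  simp only [mem_eraseLeast]
  exact fun ⟨hx, y, hy, hyx⟩ => ⟨h hx, y, h hy, hyx⟩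

lemma eraseLeast_ssubset {T : Finset A} (h : T.Nonempty) : eraseLeast T ⊂ T := by
  refine (eraseLeast_subset T).ssubset_of_mem_notMem (T.min'_mem h) fun hm => ?_
  obtain ⟨y, hy, hlt⟩ := (mem_eraseLeast.1 hm).2
  exact (T.min'_le y hy).not_gt hlt

/-- The stacks of rows (from the bottom row up) with letters in `S`, such that each row is a set of
letters of the row below, its least letter excluded. -/
def IsStack : Finset A → List (Finset A) → Prop
  | _, [] => True
  | S, T :: c => T.Nonempty ∧ T ⊆ S ∧ IsStack (eraseLeast T) c

lemma IsStack.mono {S T : Finset A} (h : S ⊆ T) {c : List (Finset A)} (hc : IsStack S c) :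
    IsStack T c := by
  cases c with
  | nil => trivial
  | cons U c => exact ⟨hc.1, hc.2.1.trans h, hc.2.2⟩

/-- The word of a stack, read row by row from the top. -/
def stackWord : List (Finset A) → FreeMonoid A
  | [] => 1
  | T :: c => stackWord c * row T

/-- The bumped letter s exceeds y, so it is a non-least letter of the new row and may be inserted
into the rows above. The available set of letters shrinks strictly, so the recursion ends. -/
lemma exists_stack_mul_of (S : Finset A) (c : List (Finset A)) (hc : IsStack S c) (y : A)
    (hy : y ∈ S) : ∃ d, IsStack S d ∧
      PresentedMonoid.mk StylicRel (stackWord c * FreeMonoid.of y) =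
        PresentedMonoid.mk StylicRel (stackWord d) := by
  induction S using Finset.strongInduction generalizing c y with
  | H S ih =>
  cases c with
  | nil =>
    refine ⟨[{y}], ⟨by simp, by simpa, trivial⟩, ?_⟩
    simp [stackWord, row]
  | cons T c =>
    obtain ⟨hT, hTS, hc⟩ := hc
    have hsub : insert y T ⊆ S := Finset.insert_subset hy hTS
    have hmono := eraseLeast_mono (Finset.subset_insert y T)
    rcases row_mul_of T y with h | ⟨s, hs, hys, h⟩
    · refine ⟨insert y T :: c, ⟨by simp, hsub, hc.mono hmono⟩, ?_⟩
      rw [stackWord, mul_assoc, map_mul, h, ← map_mul, stackWord]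
    · have hs' : s ∈ eraseLeast (insert y T) := mem_eraseLeast.2 ⟨by simp [hs], y, by simp, hys⟩
      obtain ⟨d, hd, e⟩ := ih (eraseLeast (insert y T))
        ((eraseLeast_ssubset (by simp)).trans_subset hsub) c (hc.mono hmono) s hs'
      refine ⟨insert y T :: d, ⟨by simp, hsub, hd⟩, ?_⟩
      rw [stackWord, mul_assoc, map_mul, h, ← map_mul, ← mul_assoc, map_mul, e, ← map_mul, stackWord]

lemma exists_stack_mk_eq [Fintype A] (w : FreeMonoid A) : ∃ c, IsStack Finset.univ c ∧
    PresentedMonoid.mk StylicRel (stackWord c) = PresentedMonoid.mk StylicRel w := by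
  suffices h : ∀ c : List (Finset A), IsStack Finset.univ c → ∃ d, IsStack Finset.univ d ∧
      PresentedMonoid.mk StylicRel (stackWord d) =
        PresentedMonoid.mk StylicRel (stackWord c * w) by
    simpa [stackWord] using h [] trivial
  induction w with
  | one => exact fun c hc => ⟨c, hc, by rw [mul_one]⟩
  | of x =>
    intro c hc
    obtain ⟨d, hd, e⟩ := exists_stack_mul_of _ c hc x (Finset.mem_univ x)
    exact ⟨d, hd, e.symm⟩
  | mul u v hu hv =>
    intro c hc
    obtain ⟨d, hd, e⟩ := hu c hc
    obtain ⟨d', hd', e'⟩ := hv d hd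
    exact ⟨d', hd', by rw [e', map_mul, e, ← map_mul, mul_assoc]⟩

/-! ### Ranks of columns, and the relations in the action -/

lemma mem_colInsert {x z : A} {γ : Finset A} :
    z ∈ colInsert x γ ↔ z = x ∨ z ∈ γ ∧ (z < x ∨ ∃ y ∈ γ, x ≤ y ∧ y < z) := by
  unfold colInsert
  split_ifs with h
  · have hmin := Finset.min'_mem _ h
    have hle : ∀ y ∈ γ, x ≤ y → (γ.filter (fun y => x ≤ y)).min' h ≤ y := fun y hy hxy =>
      Finset.min'_le _ _ (by simp [hy, hxy])
    generalize (γ.filter (fun y => x ≤ y)).min' h = m at hmin hle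
    simp only [Finset.mem_filter] at hmin
    simp only [Finset.mem_insert, Finset.mem_erase]
    refine or_congr_right ⟨fun ⟨hz, hzγ⟩ => ⟨hzγ, ?_⟩, fun ⟨hzγ, hz⟩ => ⟨?_, hzγ⟩⟩
    · rcases lt_or_ge z x with hzx | hzx
      · exact Or.inl hzx
      · exact Or.inr ⟨m, hmin.1, hmin.2, (hle z hzγ hzx).lt_of_ne hz.symm⟩
    · rintro rfl
      rcases hz with hz | ⟨y, hy, hxy, hyz⟩
      · exact hz.not_ge hmin.2
      · exact hyz.not_ge (hle y hy hxy)
  · rw [Finset.not_nonempty_iff_eq_empty, Finset.filter_eq_empty_iff] at h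
    simp only [Finset.mem_insert]
    refine or_congr_right ⟨fun hz => ⟨hz, Or.inl (not_le.1 (h hz))⟩, fun hz => hz.1⟩

section Rank

/-- The number of elements of a column in a given set. -/
noncomputable def rank {A : Type*} (γ : Finset A) (D : Set A) : ℕ := (↑γ ∩ D).ncard

lemma rank_mono {A : Type*} (γ : Finset A) {D E : Set A} (h : D ⊆ E) : rank γ D ≤ rank γ E :=
  Set.ncard_le_ncard (Set.inter_subset_inter_right _ h) (γ.finite_toSet.inter_of_left E)

/-- A letter x belongs to a column exactly when the rank jumps between `Set.Iio x` and `Set.Iic x`.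
-/
lemma eq_of_rank_eq {γ δ : Finset A} (h : ∀ D : Set A, IsLowerSet D → rank γ D = rank δ D) :
    γ = δ := by
  have key : ∀ (ε : Finset A) (x : A), x ∈ ε ↔ rank ε (Set.Iio x) < rank ε (Set.Iic x) := by
    intro ε x
    constructor
    · intro hx
      refine Set.ncard_lt_ncard ⟨Set.inter_subset_inter_right _ Set.Iio_subset_Iic_self, fun hs => ?_⟩
        (ε.finite_toSet.inter_of_left _)
      exact lt_irrefl x (hs ⟨hx, Set.mem_Iic.2 le_rfl⟩).2
    · intro hlt
      by_contra hx
      refine hlt.ne (congrArg Set.ncard ?_)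
      ext y
      simp only [Set.mem_inter_iff, Finset.mem_coe, Set.mem_Iio, Set.mem_Iic]
      exact and_congr_right fun hy => ⟨le_of_lt, fun h => h.lt_of_ne fun e => hx (e ▸ hy)⟩
  ext x
  rw [key, key, h _ (isLowerSet_Iio x), h _ (isLowerSet_Iic x)]

open Classical in
-- Suppose x ∈ D. If the bumped letter is in `D`, the count is unchanged and already exceeds the
-- rank of `Set.Iio x`; otherwise all letters of γ in `D` are below x, and x adds one. If x ∉ D, no
-- change occurs inside `D`.
lemma rank_colInsert (x : A) (γ : Finset A) {D : Set A} (hD : IsLowerSet D) :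
    rank (colInsert x γ) D =
      if x ∈ D then max (rank γ D) (rank γ (Set.Iio x) + 1) else rank γ D := by
  unfold rank
  have fin : ∀ (δ : Finset A) (E : Set A), (↑δ ∩ E).Finite := fun δ E => δ.finite_toSet.inter_of_left E
  by_cases hm : ∃ y ∈ γ, x ≤ y
  · obtain ⟨m, ⟨hmγ, hxm⟩, hmin⟩ : ∃ m, (m ∈ γ ∧ x ≤ m) ∧ ∀ y ∈ γ, x ≤ y → m ≤ y := by
      have h : (γ.filter (x ≤ ·)).Nonempty := by
        obtain ⟨y, hy, hxy⟩ := hm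
        exact ⟨y, by simp [hy, hxy]⟩
      refine ⟨_, Finset.mem_filter.1 (Finset.min'_mem _ h), fun y hy hxy => ?_⟩
      exact Finset.min'_le _ _ (by simp [hy, hxy])
    have hmem : ∀ z, z ∈ colInsert x γ ↔ z = x ∨ z ∈ γ ∧ z ≠ m := by
      intro z
      rw [mem_colInsert]
      grind
    by_cases hxD : x ∈ D
    · rw [if_pos hxD]
      by_cases hmD : m ∈ D
      · have h₁ : (↑(colInsert x γ) ∩ D : Set A) = insert x ((↑γ ∩ D) \ {m}) := by
          ext z; simp [hmem]; grind
        have h₂ : x ∉ ((↑γ ∩ D) \ {m} : Set A) := by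
          rintro ⟨⟨hx, -⟩, hxm'⟩
          exact hxm' (le_antisymm hxm (hmin x hx le_rfl))
        have h₃ : (↑γ ∩ Set.Iio x : Set A) ⊆ (↑γ ∩ D) \ {m} := by
          rintro z ⟨hz, hzx⟩
          exact ⟨⟨hz, hD (le_of_lt hzx) hxD⟩, fun e => hxm.not_gt (e ▸ hzx)⟩
        have h₄ := Set.ncard_le_ncard h₃ ((fin _ _).sdiff)
        have h₅ := Set.ncard_sdiff_singleton_add_one (s := ↑γ ∩ D) ⟨hmγ, hmD⟩ (fin _ _)
        rw [h₁, Set.ncard_insert_of_notMem h₂ ((fin _ _).sdiff)]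
        omega
      · have h₁ : (↑(colInsert x γ) ∩ D : Set A) = insert x (↑γ ∩ Set.Iio x) := by
          ext z
          simp only [Set.mem_inter_iff, Finset.mem_coe, hmem, Set.mem_insert_iff, Set.mem_Iio]
          constructor
          · rintro ⟨rfl | ⟨hz, -⟩, hzD⟩
            · exact Or.inl rfl
            · exact Or.inr ⟨hz, not_le.1 fun hxz => hmD (hD (hmin z hz hxz) hzD)⟩
          · rintro (rfl | ⟨hz, hzx⟩)
            · exact ⟨Or.inl rfl, hxD⟩
            · exact ⟨Or.inr ⟨hz, fun e => hxm.not_gt (e ▸ hzx)⟩, hD hzx.le hxD⟩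
        have h₂ : (↑γ ∩ D : Set A) = ↑γ ∩ Set.Iio x := by
          ext z
          simp only [Set.mem_inter_iff, Finset.mem_coe, Set.mem_Iio]
          exact and_congr_right fun hz => ⟨fun hzD => not_le.1 fun hxz => hmD (hD (hmin z hz hxz) hzD),
            fun hzx => hD hzx.le hxD⟩
        rw [h₁, Set.ncard_insert_of_notMem (by simp) (fin _ _), h₂]
        omega
    · rw [if_neg hxD]
      have hmD : m ∉ D := fun h => hxD (hD hxm h)
      congr 1
      ext z
      simp only [Set.mem_inter_iff, Finset.mem_coe, hmem]
      grind
  · push Not at hm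
    have hmem : ∀ z, z ∈ colInsert x γ ↔ z = x ∨ z ∈ γ := by
      intro z
      rw [mem_colInsert]
      grind
    by_cases hxD : x ∈ D
    · have h₁ : (↑(colInsert x γ) ∩ D : Set A) = insert x (↑γ ∩ D) := by
        ext z; simp [hmem]; grind
      have h₂ : (↑γ ∩ D : Set A) = ↑γ ∩ Set.Iio x := by
        ext z
        simp only [Set.mem_inter_iff, Finset.mem_coe, Set.mem_Iio]
        exact and_congr_right fun hz => ⟨fun _ => hm z hz, fun hzx => hD hzx.le hxD⟩
      rw [if_pos hxD, h₁, h₂, Set.ncard_insert_of_notMem (by simp) (fin _ _)]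
      omega
    · rw [if_neg hxD]
      congr 1
      ext z
      simp only [Set.mem_inter_iff, Finset.mem_coe, hmem]
      grind

end Rank

/-- After `rank_colInsert`, each relation is a max-plus identity in the ranks of γ on `D` and on the
sets `Set.Iio`; monotonicity in the letters suffices. -/
lemma lift_letterAct_eq_of_stylicRel (u v : FreeMonoid A) (h : StylicRel u v) :
    FreeMonoid.lift letterAct u = FreeMonoid.lift letterAct v := by
  have mul : ∀ (e f : Function.End (Finset A)) (γ : Finset A), (e * f) γ = e (f γ) :=
    fun _ _ _ => rfl
  have act : ∀ (x : A) (γ : Finset A), letterAct x γ = colInsert x γ := fun _ _ => rfl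
  refine funext fun γ => eq_of_rank_eq fun D hD => ?_
  have mem : ∀ {x y : A}, x < y → y ∈ D → x ∈ D := fun hxy hy => hD hxy.le hy
  have mono : ∀ {x y : A}, x < y → rank γ (Set.Iio x) ≤ rank γ (Set.Iio y) := fun hxy =>
    rank_mono γ (Set.Iio_subset_Iio hxy.le)
  cases h with
  | plactic _ _ h =>
    cases h with
    | bac_bca a b c hab hbc =>
      have h₁ := mem hab
      have h₂ := mem hbc
      have h₃ := mono hab
      have h₄ := mono hbc
      simp only [map_mul, FreeMonoid.lift_eval_of, mul, act, rank_colInsert _ _ hD,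
        rank_colInsert _ _ (isLowerSet_Iio _), Set.mem_Iio, hab, hab.trans hbc, hbc.not_gt,
        (hab.trans hbc).not_gt, if_true, if_false]
      split_ifs <;> first | omega | simp_all
    | acb_cab a b c hab hbc =>
      have h₁ := mem hab
      have h₂ := mem hbc
      have h₃ := mono hab
      have h₄ := mono hbc
      simp only [map_mul, FreeMonoid.lift_eval_of, mul, act, rank_colInsert _ _ hD,
        rank_colInsert _ _ (isLowerSet_Iio _), Set.mem_Iio, hbc, hab.trans hbc, hab.not_gt,
        (hab.trans hbc).not_gt, if_true, if_false]
      split_ifs <;> omega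
    | baa_aba a b hab =>
      have h₁ := mem hab
      have h₃ := mono hab
      simp only [map_mul, FreeMonoid.lift_eval_of, mul, act, rank_colInsert _ _ hD,
        rank_colInsert _ _ (isLowerSet_Iio _), Set.mem_Iio, hab, hab.not_gt,
        lt_irrefl, if_true, if_false]
      split_ifs <;> omega
    | bba_bab a b hab =>
      have h₁ := mem hab
      have h₃ := mono hab
      simp only [map_mul, FreeMonoid.lift_eval_of, mul, act, rank_colInsert _ _ hD,
        rank_colInsert _ _ (isLowerSet_Iio _), Set.mem_Iio, hab, hab.not_gt,
        lt_irrefl, if_true, if_false]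
      split_ifs <;> omega
  | idem x =>
    simp only [pow_two, map_mul, FreeMonoid.lift_eval_of, mul, act, rank_colInsert _ _ hD,
      rank_colInsert _ _ (isLowerSet_Iio _), Set.mem_Iio, lt_irrefl, if_false]
    split_ifs <;> omega

/-! ### Stacks are separated by their action -/

lemma wordAct_mul_apply (u v : FreeMonoid A) (γ : Finset A) :
    wordAct A (u * v) γ = wordAct A u (wordAct A v γ) := by
  rw [map_mul]; rfl

lemma wordAct_of_apply (x : A) (γ : Finset A) : wordAct A (FreeMonoid.of x) γ = colInsert x γ := by
  rw [wordAct, FreeMonoid.lift_eval_of]; rfl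

lemma wordAct_one_apply (γ : Finset A) : wordAct A 1 γ = γ := by
  rw [map_one]; rfl

/-- If a column contains all letters below `x`, then a word acting on it adds `x` to it exactly
when `x` occurs in the word. -/
lemma mem_wordAct_iff (w : FreeMonoid A) {x : A} {γ : Finset A} (h : ∀ z < x, z ∈ γ) :
    x ∈ wordAct A w γ ↔ x ∈ w.toList ∨ x ∈ γ := by
  induction w generalizing x γ with
  | one => simp [wordAct_one_apply]
  | of y =>
    rw [wordAct_of_apply, mem_colInsert, FreeMonoid.toList_of, List.mem_singleton]
    rcases lt_trichotomy x y with hxy | rfl | hxy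
    · simp [hxy, hxy.ne]
    · simp
    · simp only [hxy.ne', hxy.not_gt, false_or, and_iff_left_iff_imp]
      exact fun _ => ⟨y, h y hxy, le_rfl, hxy⟩
  | mul u v hu hv =>
    have hv' : ∀ z < x, z ∈ wordAct A v γ := fun z hz =>
      (hv fun y hy => h y (hy.trans hz)).2 (Or.inr (h z hz))
    rw [wordAct_mul_apply, hu hv', hv h, FreeMonoid.toList_mul, List.mem_append, or_assoc]

/-- A letter already in the column bumps itself. -/
lemma wordAct_eq_self (w : FreeMonoid A) {γ : Finset A} (h : ∀ x ∈ w.toList, ∀ z ≤ x, z ∈ γ) :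
    wordAct A w γ = γ := by
  induction w with
  | one => exact wordAct_one_apply γ
  | of y =>
    rw [wordAct_of_apply]
    ext z
    rw [mem_colInsert]
    have := h y (by simp)
    grind
  | mul u v hu hv =>
    simp only [FreeMonoid.toList_mul, List.mem_append] at h
    rw [wordAct_mul_apply, hv fun x hx => h x (Or.inr hx), hu fun x hx => h x (Or.inl hx)]

/-- The greatest letter is inserted first, on top of γ; each later letter bumps its predecessor, so
only t remains. -/
lemma wordAct_ofList_increasing {t : A} (R : List A) (h : (t :: R).Pairwise (· < ·)) {γ : Finset A}
    (hγ : ∀ z ∈ γ, z < t) : wordAct A (FreeMonoid.ofList (t :: R)) γ = insert t γ := by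
  induction R generalizing t with
  | nil =>
    rw [FreeMonoid.ofList_singleton, wordAct_of_apply]
    ext z
    rw [mem_colInsert, Finset.mem_insert]
    grind
  | cons c R ih =>
    have h' := List.pairwise_cons.1 h
    have htc : t < c := h'.1 c (by simp)
    rw [FreeMonoid.ofList_cons, wordAct_mul_apply, ih h'.2 fun z hz => (hγ z hz).trans htc,
      wordAct_of_apply]
    ext z
    rw [mem_colInsert, Finset.mem_insert]
    grind

/-- The letters of `T` from t upwards act first and add t alone; the letters below t then act
trivially on an initial segment containing them. -/
lemma wordAct_row [Fintype A] {T : Finset A} {t : A} (ht : t ∈ T) :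
    wordAct A (row T) (Finset.univ.filter (· < t)) = Finset.univ.filter (· ≤ t) := by
  have hp : (t :: (T.filter (t < ·)).sort).Pairwise (· < ·) :=
    List.pairwise_cons.2 ⟨by simp, (Finset.sortedLT_sort _).pairwise⟩
  have hi : insert t (Finset.univ.filter (· < t)) = Finset.univ.filter (· ≤ t) := by
    ext z
    simp [le_iff_eq_or_lt]
  rw [row, sort_eq_filter_append t T, if_pos ht, List.append_assoc, List.singleton_append,
    FreeMonoid.ofList_append, wordAct_mul_apply, wordAct_ofList_increasing _ hp (by simp), hi]
  refine wordAct_eq_self _ fun x hx z hz => ?_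
  rw [FreeMonoid.toList_ofList, Finset.mem_sort, Finset.mem_filter] at hx
  simpa using hz.trans hx.2.le

/-- If no letter of a word lies strictly between `u` and `x`, then the letters in this interval
remain inert in a column containing all letters up to `u`. -/
lemma mem_wordAct_filter_lt_iff [Fintype A] {u x : A} (hux : u < x) (w : FreeMonoid A)
    (hw : ∀ y ∈ w.toList, y ≤ u ∨ x ≤ y) {γ δ : Finset A} (hγ : ∀ z ≤ u, z ∈ γ)
    (hδ : ∀ z, z ∈ δ ↔ z ∈ γ ∨ u < z ∧ z < x) (z : A) :
    z ∈ wordAct A w δ ↔ z ∈ wordAct A w γ ∨ u < z ∧ z < x := by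
  induction w generalizing γ δ z with
  | one => simpa only [wordAct_one_apply] using hδ z
  | of y =>
    have := hw y (by simp)
    rw [wordAct_of_apply, wordAct_of_apply, mem_colInsert, mem_colInsert]
    -- For y ≤ u, both columns contain y and are fixed. For x ≤ y, both have the same letters ≥ y,
    -- so the same letter, if any, is bumped.
    rcases this with hy | hy
    · have := hγ y hy
      grind
    · grind
  | mul v v' hv hv' =>
    simp only [FreeMonoid.toList_mul, List.mem_append] at hw
    rw [wordAct_mul_apply, wordAct_mul_apply]
    refine hv (fun y hy => hw y (Or.inl hy)) (fun y hy => ?_)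
      (hv' (fun y hy => hw y (Or.inr hy)) hγ hδ) z
    exact (mem_wordAct_iff v' fun z hz => hγ z (hz.le.trans hy)).2 (Or.inr (hγ y hy))

lemma mem_stackWord_of_isStack {S : Finset A} {c : List (Finset A)} (hc : IsStack S c) :
    ∀ x ∈ (stackWord c).toList, x ∈ S := by
  induction c generalizing S with
  | nil => simp [stackWord]
  | cons T c ih =>
    intro x hx
    rw [stackWord, FreeMonoid.toList_mul, List.mem_append] at hx
    rcases hx with hx | hx
    · exact hc.2.1 (eraseLeast_subset T (ih hc.2.2 x hx))
    · exact hc.2.1 (by simpa [row] using hx)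

lemma mem_stackWord_cons {S T : Finset A} {c : List (Finset A)} (hc : IsStack S (T :: c)) (x : A) :
    x ∈ (stackWord (T :: c)).toList ↔ x ∈ T := by
  rw [stackWord, FreeMonoid.toList_mul, List.mem_append]
  constructor
  · rintro (h | h)
    · exact eraseLeast_subset T (mem_stackWord_of_isStack hc.2.2 x h)
    · simpa [row] using h
  · exact fun h => Or.inr (by simpa [row] using h)

/-- The letters of a stack word are those of its bottom row, and `mem_wordAct_iff` detects them, so
the bottom rows agree. A common bottom row `T` sends the letters < t to the letters ≤ t for t ∈ T,
so the remaining rows act equally on the latter segments. Only tests at x ∈ S are assumed, as only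
those pass to the induction. -/
lemma stack_eq_of_wordAct_eq [Fintype A] {S : Finset A} {c d : List (Finset A)} (hc : IsStack S c)
    (hd : IsStack S d) (h : ∀ x ∈ S, wordAct A (stackWord c) (Finset.univ.filter (· < x)) =
      wordAct A (stackWord d) (Finset.univ.filter (· < x))) : c = d := by
  have letters : ∀ x ∈ S, x ∈ (stackWord c).toList ↔ x ∈ (stackWord d).toList := by
    intro x hx
    have hm := fun w => mem_wordAct_iff w (x := x) (γ := Finset.univ.filter (· < x)) (by simp)
    have h₁ := hm (stackWord c)
    have h₂ := hm (stackWord d)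
    rw [h x hx, h₂] at h₁
    simpa using h₁.symm
  induction c generalizing S d with
  | nil =>
    cases d with
    | nil => rfl
    | cons T d =>
      obtain ⟨t, ht⟩ := hd.1
      have := (letters t (hd.2.1 ht)).2 ((mem_stackWord_cons hd t).2 ht)
      simp [stackWord] at this
  | cons T c ih =>
    cases d with
    | nil =>
      obtain ⟨t, ht⟩ := hc.1
      have := (letters t (hc.2.1 ht)).1 ((mem_stackWord_cons hc t).2 ht)
      simp [stackWord] at this
    | cons U d =>
      obtain rfl : T = U := by
        ext x
        rw [← mem_stackWord_cons hc, ← mem_stackWord_cons hd]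
        by_cases hx : x ∈ S
        · exact letters x hx
        · exact iff_of_false (fun h => hx (mem_stackWord_of_isStack hc x h))
            (fun h => hx (mem_stackWord_of_isStack hd x h))
      have hle : ∀ t ∈ T, wordAct A (stackWord c) (Finset.univ.filter (· ≤ t)) =
          wordAct A (stackWord d) (Finset.univ.filter (· ≤ t)) := by
        intro t ht
        have := h t (hc.2.1 ht)
        rwa [stackWord, stackWord, wordAct_mul_apply, wordAct_mul_apply, wordAct_row ht] at this
      have hlt : ∀ x ∈ eraseLeast T, wordAct A (stackWord c) (Finset.univ.filter (· < x)) =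
          wordAct A (stackWord d) (Finset.univ.filter (· < x)) := by
        intro x hx
        obtain ⟨hxT, y, hy, hyx⟩ := mem_eraseLeast.1 hx
        -- Here u is the predecessor of x in `T`. The upper rows have no letters strictly between u
        -- and x, so their action on the letters < x follows from that on the letters ≤ u.
        obtain ⟨u, hu, hmax⟩ := (T.filter (· < x)).exists_max_image id ⟨y, by simp [hy, hyx]⟩
        rw [Finset.mem_filter] at hu
        have gap : ∀ z ∈ T, z ≤ u ∨ x ≤ z := fun z hz => by
          rcases lt_or_ge z x with hzx | hzx
          · exact Or.inl (hmax z (by simp [hz, hzx]))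
          · exact Or.inr hzx
        have key : ∀ e : List (Finset A), IsStack (eraseLeast T) e → ∀ z,
            z ∈ wordAct A (stackWord e) (Finset.univ.filter (· < x)) ↔
              z ∈ wordAct A (stackWord e) (Finset.univ.filter (· ≤ u)) ∨ u < z ∧ z < x :=
          fun e he => mem_wordAct_filter_lt_iff hu.2 _
            (fun z hz => gap z (eraseLeast_subset T (mem_stackWord_of_isStack he z hz)))
            (by simp) (fun z => by
              simp only [Finset.mem_filter, Finset.mem_univ, true_and]
              have := hu.2
              grind)
        ext z
        rw [key c hc.2.2, key d hd.2.2, hle u hu.1]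
      have letters' : ∀ x ∈ eraseLeast T,
          x ∈ (stackWord c).toList ↔ x ∈ (stackWord d).toList := by
        intro x hx
        have hm := fun w => mem_wordAct_iff w (x := x) (γ := Finset.univ.filter (· < x)) (by simp)
        have h₁ := hm (stackWord c)
        have h₂ := hm (stackWord d)
        rw [hlt x hx, h₂] at h₁
        simpa using h₁.symm
      rw [ih hc.2.2 hd.2.2 hlt letters']

/-! ### The isomorphism and the parametrization by stacks -/

/-- The homomorphism from the monoid presented by the stylic relations to the stylic monoid. -/
def presentedToStyl (A : Type*) [LinearOrder A] :
    PresentedMonoid (StylicRel (A := A)) →* Styl A :=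
  PresentedMonoid.lift (fun x => toStyl A (FreeMonoid.of x)) fun u v h => by
    have e : FreeMonoid.lift (fun x => toStyl A (FreeMonoid.of x)) = toStyl A :=
      FreeMonoid.hom_eq fun x => by rw [FreeMonoid.lift_eval_of]
    rw [e]
    exact Subtype.ext (lift_letterAct_eq_of_stylicRel u v h)

lemma presentedToStyl_mk (w : FreeMonoid A) :
    presentedToStyl A (PresentedMonoid.mk StylicRel w) = toStyl A w :=
  DFunLike.congr_fun (f := (presentedToStyl A).comp (PresentedMonoid.mk StylicRel))
    (g := toStyl A) (FreeMonoid.hom_eq fun _ => rfl) w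

lemma stackWord_toStyl_injective [Fintype A] :
    Function.Injective fun c : {c : List (Finset A) // IsStack Finset.univ c} =>
      toStyl A (stackWord c.1) := by
  intro c d h
  refine Subtype.ext (stack_eq_of_wordAct_eq c.2 d.2 fun x _ => ?_)
  exact congrFun (congrArg Subtype.val h) _

lemma presentedToStyl_bijective [Fintype A] : Function.Bijective (presentedToStyl A) := by
  constructor
  · intro p q h
    obtain ⟨u, rfl⟩ := PresentedMonoid.surjective_mk p
    obtain ⟨v, rfl⟩ := PresentedMonoid.surjective_mk q
    obtain ⟨c, hc, ec⟩ := exists_stack_mk_eq u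
    obtain ⟨d, hd, ed⟩ := exists_stack_mk_eq v
    rw [← ec, ← ed] at h ⊢
    rw [presentedToStyl_mk, presentedToStyl_mk] at h
    obtain rfl : c = d := Subtype.ext_iff.1
      (stackWord_toStyl_injective (a₁ := ⟨c, hc⟩) (a₂ := ⟨d, hd⟩) h)
    rfl
  · intro f
    obtain ⟨w, rfl⟩ := (wordAct A).mrangeRestrict_surjective f
    exact ⟨PresentedMonoid.mk StylicRel w, presentedToStyl_mk w⟩

lemma stackWord_toStyl_bijective [Fintype A] :
    Function.Bijective fun c : {c : List (Finset A) // IsStack Finset.univ c} =>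
      toStyl A (stackWord c.1) := by
  refine ⟨stackWord_toStyl_injective, fun f => ?_⟩
  obtain ⟨w, rfl⟩ := (wordAct A).mrangeRestrict_surjective f
  obtain ⟨c, hc, e⟩ := exists_stack_mk_eq w
  have := congrArg (presentedToStyl A) e
  rw [presentedToStyl_mk, presentedToStyl_mk] at this
  exact ⟨⟨c, hc⟩, this⟩

/-! ### Bell numbers and partitions -/

section Counting

open Finset

lemma bell_succ_eq_sum_powerset {α : Type*} (s : Finset α) :
    Nat.bell (#s + 1) = ∑ t ∈ s.powerset, Nat.bell #t := by
  rw [Finset.sum_powerset_apply_card, Nat.bell_succ', Finset.Nat.sum_antidiagonal_eq_sum_range_succ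
    (fun x y ↦ Nat.choose #s x * y.bell) #s, ← Finset.sum_range_reflect]
  refine Finset.sum_congr rfl fun k hk => ?_
  have hk : k ≤ #s := by simpa [Nat.lt_succ_iff] using hk
  simp [Nat.choose_symm hk, Nat.sub_sub_self hk]

/-- The subset recursion for a set with one extra point, split by whether the subset contains that
point; this is the shape of the recursion for stacks. -/
lemma bell_succ_succ_eq_sum_powerset {α : Type*} (s : Finset α) :
    Nat.bell (#s + 2) = Nat.bell (#s + 1) + ∑ t ∈ s.powerset, Nat.bell (#t + 1) := by
  classical
  have h := bell_succ_eq_sum_powerset (insertNone s)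
  rw [card_insertNone] at h
  rw [h]
  have hp : (insertNone s).powerset = s.powerset.image (fun t => t.map .some) ∪
      s.powerset.image insertNone := by
    ext t
    simp only [mem_powerset, mem_union, mem_image]
    constructor
    · intro ht
      have hs : eraseNone t ⊆ s := fun x hx => by
        have := ht (mem_eraseNone.1 hx)
        simpa using this
      by_cases hn : none ∈ t
      · exact Or.inr ⟨eraseNone t, hs, by simp [hn]⟩
      · exact Or.inl ⟨eraseNone t, hs, by simp [hn]⟩
    · rintro (⟨u, hu, rfl⟩ | ⟨u, hu, rfl⟩)
      · intro x
        simp only [mem_map]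
        rintro ⟨y, hy, rfl⟩
        simpa using hu hy
      · simpa using hu
  rw [hp, sum_union, sum_image, sum_image, bell_succ_eq_sum_powerset]
  · simp
  · intro x _ y _ h
    simpa using congrArg eraseNone h
  · intro x _ y _ h
    simpa using congrArg eraseNone h
  · rw [disjoint_left]
    intro x hx hy
    simp only [mem_image] at hx hy
    obtain ⟨u, -, rfl⟩ := hx
    obtain ⟨v, -, h⟩ := hy
    have : none ∈ insertNone v := by simp
    rw [h] at this
    simp at this

/-- A partition of a subset of `s` extended to `insert a s` by one part containing `a`. -/
def extendPartition {α : Type*} [DecidableEq α] {s : Finset α} {a : α} (ha : a ∉ s)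
    (P : Σ t : s.powerset, Finpartition t.1) : Finpartition (insert a s) :=
  P.2.extend (b := insert a s \ P.1.1)
    (by
      have : a ∈ insert a s \ P.1.1 := by
        simp only [mem_sdiff, mem_insert, true_or, true_and]
        exact fun h => ha (mem_powerset.1 P.1.2 h)
      exact ne_empty_of_mem this)
    disjoint_sdiff
    (by
      rw [sup_eq_union, union_sdiff_of_subset]
      exact (mem_powerset.1 P.1.2).trans (subset_insert a s))

/-- The inverse removes the part containing a; the other parts partition its complement. -/
lemma extendPartition_bijective {α : Type*} [DecidableEq α] {s : Finset α} {a : α} (ha : a ∉ s) :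
    Function.Bijective (extendPartition ha) := by
  have mem : ∀ t : s.powerset, a ∈ insert a s \ t.1 := fun t => by
    simp only [mem_sdiff, mem_insert, true_or, true_and]
    exact fun h => ha (mem_powerset.1 t.2 h)
  have part_eq : ∀ P, (extendPartition ha P).part a = insert a s \ P.1.1 := fun P =>
    Finpartition.part_eq_of_mem _ (by simp [extendPartition]) (mem P.1)
  have parts_eq : ∀ P, P.2.parts = (extendPartition ha P).parts.erase
      ((extendPartition ha P).part a) := fun P => by
    rw [part_eq, extendPartition, Finpartition.extend]
    refine (erase_insert fun h => ?_).symm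
    exact ha (mem_powerset.1 P.1.2 (P.2.le h (mem P.1)))
  constructor
  · rintro P Q h
    have h₁ := part_eq P
    rw [h, part_eq Q] at h₁
    have h₂ := parts_eq P
    rw [h, ← parts_eq Q] at h₂
    obtain ⟨⟨t, ht⟩, P⟩ := P
    obtain ⟨⟨u, hu⟩, Q⟩ := Q
    have hi : ∀ v ∈ s.powerset, insert a s \ (insert a s \ v) = v := fun v hv =>
      _root_.sdiff_sdiff_eq_self ((mem_powerset.1 hv).trans (subset_insert a s))
    obtain rfl : t = u := by
      have := congrArg (insert a s \ ·) h₁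
      simpa only [hi t ht, hi u hu] using this.symm
    congr 1
    exact Finpartition.ext h₂
  · intro P
    have hmem : a ∈ P.part a := by simp
    have hpart : P.part a ∈ P.parts := by simp
    have hsup : (P.parts.erase (P.part a)).sup id = insert a s \ P.part a := by
      ext x
      simp only [mem_sup, mem_erase, id, mem_sdiff]
      constructor
      · rintro ⟨v, ⟨hne, hv⟩, hx⟩
        exact ⟨P.le hv hx, fun hx' => hne (P.eq_of_mem_parts hv hpart hx hx')⟩
      · rintro ⟨hx, hx'⟩
        obtain ⟨v, hv, hxv⟩ := P.exists_mem hx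
        exact ⟨v, ⟨fun e => hx' (e ▸ hxv), hv⟩, hxv⟩
    refine ⟨⟨⟨insert a s \ P.part a, ?_⟩, P.ofSubset (erase_subset _ _) hsup⟩, ?_⟩
    · rw [mem_powerset]
      intro x hx
      rw [mem_sdiff, mem_insert] at hx
      rcases hx.1 with rfl | h
      · exact absurd hmem hx.2
      · exact h
    · apply Finpartition.ext
      simp only [extendPartition, Finpartition.extend, Finpartition.ofSubset]
      rw [_root_.sdiff_sdiff_eq_self (P.le hpart), insert_erase hpart]

lemma card_finpartition {α : Type*} [DecidableEq α] (s : Finset α) :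
    Nat.card (Finpartition s) = Nat.bell #s := by
  induction s using Finset.strongInduction with
  | H s ih =>
  rcases s.eq_empty_or_nonempty with rfl | ⟨a, has⟩
  · have : Nat.card (Finpartition (⊥ : Finset α)) = 1 := Nat.card_unique
    simpa using this
  · obtain ⟨ha, hs⟩ : a ∉ s.erase a ∧ insert a (s.erase a) = s := by simp [has]
    generalize s.erase a = t at ha hs
    subst hs
    rw [← Nat.card_congr (Equiv.ofBijective _ (extendPartition_bijective ha)), Nat.card_sigma,
      card_insert_of_notMem ha, bell_succ_eq_sum_powerset, ← sum_coe_sort t.powerset]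
    exact sum_congr rfl fun u _ => ih u
      ((mem_powerset.1 u.2).trans_ssubset (ssubset_insert ha))

end Counting

/-! ### Counting stacks -/

lemma eraseLeast_insert {a : A} {T : Finset A} (h : ∀ x ∈ T, a < x) :
    eraseLeast (insert a T) = T := by
  ext x
  simp only [mem_eraseLeast, Finset.mem_insert]
  constructor
  · rintro ⟨rfl | hx, y, rfl | hy, hlt⟩
    · exact absurd hlt (lt_irrefl _)
    · exact absurd (hlt.trans (h y hy)) (lt_irrefl _)
    · exact hx
    · exact hx
  · exact fun hx => ⟨Or.inr hx, a, Or.inl rfl, h x hx⟩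

/-- A stack with letters in `S`, or a stack with letters in a subset of `S` put upon the row made of
this subset and `a`. -/
def extendStack {S : Finset A} {a : A} (h : ∀ x ∈ S, a < x) :
    {c // IsStack S c} ⊕ (Σ T : S.powerset, {c // IsStack T.1 c}) → {c // IsStack (insert a S) c}
  | .inl c => ⟨c.1, c.2.mono (Finset.subset_insert a S)⟩
  | .inr ⟨T, c⟩ => ⟨insert a T.1 :: c.1, by simp,
      Finset.insert_subset_insert a (Finset.mem_powerset.1 T.2), by
        rw [eraseLeast_insert fun x hx => h x (Finset.mem_powerset.1 T.2 hx)]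
        exact c.2⟩

/-- The two summands correspond to a being absent from or present in the bottom row. In the latter
case a is the least letter, so the rows above have exactly the rest of that row at their disposal.
-/
lemma extendStack_bijective {S : Finset A} {a : A} (h : ∀ x ∈ S, a < x) :
    Function.Bijective (extendStack h) := by
  have ha : a ∉ S := fun hm => lt_irrefl a (h a hm)
  have hT : ∀ T : S.powerset, a ∉ T.1 := fun T hm => ha (Finset.mem_powerset.1 T.2 hm)
  have hne : ∀ (c : {c // IsStack S c}) (T : S.powerset) (d : {c // IsStack T.1 c}),
      c.1 ≠ insert a T.1 :: d.1 := by
    rintro ⟨c, hc⟩ T d rfl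
    exact ha (hc.2.1 (Finset.mem_insert_self a T.1))
  constructor
  · rintro (c | ⟨T, c⟩) (d | ⟨U, d⟩) e
    · have e' : c.1 = d.1 := congrArg (fun f => f.1) e
      rw [Subtype.ext e']
    · exact absurd (congrArg Subtype.val e) (hne c U d)
    · exact absurd (congrArg Subtype.val e).symm (hne d T c)
    · obtain ⟨e₁, e₂⟩ := List.cons.inj (congrArg Subtype.val e)
      obtain rfl : T = U := by
        refine Subtype.ext ?_
        rw [← Finset.erase_insert (hT T), e₁, Finset.erase_insert (hT U)]
      rw [Subtype.ext e₂]
  · rintro ⟨c, hc⟩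
    cases c with
    | nil => exact ⟨.inl ⟨[], trivial⟩, rfl⟩
    | cons T c =>
      by_cases haT : a ∈ T
      · have hsub : T.erase a ⊆ S := by
          intro x hx
          rw [Finset.mem_erase] at hx
          exact (Finset.mem_insert.1 (hc.2.1 hx.2)).resolve_left hx.1
        have e : insert a (T.erase a) = T := Finset.insert_erase haT
        have hc' : IsStack (T.erase a) c := by
          rw [← eraseLeast_insert fun x hx => h x (hsub hx), e]
          exact hc.2.2
        exact ⟨.inr ⟨⟨T.erase a, Finset.mem_powerset.2 hsub⟩, ⟨c, hc'⟩⟩,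
          Subtype.ext (congrArg (· :: c) e)⟩
      · exact ⟨.inl ⟨T :: c, hc.1, (Finset.subset_insert_iff_of_notMem haT).1 hc.2.1, hc.2.2⟩, rfl⟩

-- Finiteness is carried through the induction because `Nat.card` of an infinite type is 0, which
-- would spoil the sum formulas.
lemma finite_and_card_stack (S : Finset A) : Finite {c // IsStack S c} ∧
    Nat.card {c // IsStack S c} = Nat.bell (S.card + 1) := by
  induction S using Finset.strongInduction with
  | H S ih =>
  rcases S.eq_empty_or_nonempty with rfl | hS
  · have : Unique {c : List (Finset A) // IsStack ∅ c} :=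
      { default := ⟨[], trivial⟩
        uniq := by
          rintro ⟨_ | ⟨T, c⟩, hc⟩
          · rfl
          · exact absurd (Finset.subset_empty.1 hc.2.1) hc.1.ne_empty }
    exact ⟨inferInstance, by simp⟩
  · obtain ⟨a, T, h, rfl⟩ : ∃ a T, (∀ x ∈ T, a < x) ∧ S = insert a T := by
      refine ⟨S.min' hS, S.erase (S.min' hS), fun x hx => ?_,
        (Finset.insert_erase (S.min'_mem hS)).symm⟩
      exact S.min'_lt_of_mem_erase_min' hS hx
    have ha : a ∉ T := fun hm => lt_irrefl a (h a hm)
    have hT := ih T (Finset.ssubset_insert ha)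
    have hU : ∀ U : T.powerset, _ := fun U => ih U.1
      ((Finset.mem_powerset.1 U.2).trans_ssubset (Finset.ssubset_insert ha))
    have := hT.1
    have := fun U => (hU U).1
    refine ⟨Finite.of_surjective _ (extendStack_bijective h).2, ?_⟩
    rw [← Nat.card_congr (Equiv.ofBijective _ (extendStack_bijective h)), Nat.card_sum,
      Nat.card_sigma, hT.2, Finset.card_insert_of_notMem ha, bell_succ_succ_eq_sum_powerset,
      ← Finset.sum_coe_sort T.powerset]
    exact congrArg _ (Finset.sum_congr rfl fun U _ => (hU U).2)

end Stylic

theorem theorem7p1 {A : Type*} [LinearOrder A] [Finite A] :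
    (∀ n : ℕ, Nat.card A = n → Nat.card (Stylic.Styl A) = Stylic.bellNumber (n + 1)) ∧
    (∃ e : PresentedMonoid (Stylic.StylicRel (A := A)) ≃* Stylic.Styl A,
      ∀ x : A, e (PresentedMonoid.of Stylic.StylicRel x) =
        Stylic.toStyl A (FreeMonoid.of x)) := by
  have := Fintype.ofFinite A
  refine ⟨fun n hn => ?_, MulEquiv.ofBijective (Stylic.presentedToStyl A)
    Stylic.presentedToStyl_bijective, fun x => Stylic.presentedToStyl_mk (FreeMonoid.of x)⟩
  rw [← Nat.card_congr (Equiv.ofBijective _ Stylic.stackWord_toStyl_bijective),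
    (Stylic.finite_and_card_stack Finset.univ).2, Stylic.bellNumber, Stylic.card_finpartition,
    Finset.card_univ, Finset.card_univ, Fintype.card_fin, ← Nat.card_eq_fintype_card, hn]
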